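/- All Banach spaces are complex and $B_E$ denotes the open unit ball of $E$. A Banach operator ideal $\mathcal A$ assigns to Banach spaces $Z,Y$ a linear subspace $\mathcal A(Z;Y)$ of the bounded operators, containing the finite rank operators, with a complete norm $\|\cdot\|_{\mathcal A}$, such that $RTS\in\mathcal A$ and $\|RTS\|_{\mathcal A}\le\|R\|\,\|T\|_{\mathcal A}\,\|S\|$ for $T\in\mathcal A$ and bounded operators $R,S$ that can be composed with $T$, and such that $\|\mathrm{id}_{\mathbb C}\|_{\mathcal A}=1$. A set $K\subset Y$ is relatively $\mathcal A$-compact if $K\subset T(M)$ for some Banach space $Z$, some $T\in\mathcal A(Z;Y)$ and some compact $M\subset Z$; its size $m_{\mathcal A}(K,Y)$ is the infimum of $\|T\|_{\mathcal A}$ over all such $Z$, $T$, $M$ with $M\subset B_Z$. A bounded operator $T\colon Z\to Y$ is $\mathcal A$-compact if $T(B_Z)$ is relatively $\mathcal A$-compact, and then $\|T\|_{\mathcal K_{\mathcal A}}=m_{\mathcal A}(T(B_Z),Y)$. For a homogeneous polynomial $P\colon E\to Y$ let $\|P\|_{\mathcal K_{\mathcal A}}$ be the infimum of $\|T\|_{\mathcal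 K_{\mathcal A}}$ over all Banach spaces $Z$ and $\mathcal A$-compact operators $T\colon Z\to Y$ with $P(B_E)\subset T(B_Z)$ (and $\infty$ if there are none). A holomorphic map $f\colon E\to Y$ is $\mathcal A$-compact at $x$ if $f(x+\varepsilon B_E)$ is relatively $\mathcal A$-compact for some $\varepsilon>0$, and $\mathcal A$-compact if this holds at every $x\in E$. If $f=\sum_n P_nf(x_0)(\cdot-x_0)$ is its Taylor series at $x_0$, put $r_{\mathcal K_{\mathcal A}}(f,x_0)=1/\limsup_n\|P_nf(x_0)\|_{\mathcal K_{\mathcal A}}^{1/n}$ if $f$ is $\mathcal A$-compact at $x_0$, and $r_{\mathcal K_{\mathcal A}}(f,x_0)=0$ otherwise. Let $\mathcal A$ and $\mathcal B$ be Banach operator ideals and let $X$ be a Banach space that contains a relatively $\mathcal B$-compact set which is not relatively $\mathcal A$-compact. Then there is a holomorphic map $f\colon\ell_1\to X$ which is $\mathcal B$-compact, is $\mathcal A$-compact at $0$ with $r_{\mathcal K_{\mathcal A}}(f,0)=1$, and is $\mathcal A$-compact at every point of the open unit ball $r_{\mathcal K_{\mathcal A}}(f,0)B_{\ell_1}=B_{\ell_1}$,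 but is not $\mathcal A$-compact at the first canonical basis vector $e_1$, which has norm $1$. (So the ball of radius $r_{\mathcal K_{\mathcal A}}(f,x_0)$ around $x_0$, on which a holomorphic map that is $\mathcal A$-compact at $x_0$ is always $\mathcal A$-compact, cannot be enlarged to include boundary points.) -/

import Mathlib

open Filter Topology Metric
open scoped ENNReal

universe u v

/-- A Banach operator ideal: for all complex Banach spaces `X`, `Y` a linear subspace `ops X Y` of
the bounded operators, containing the finite rank operators, stable under composition with bounded
operators on both sides, with a complete norm on every component that satisfies
`‖R ∘ T ∘ S‖ ≤ ‖R‖ ‖T‖ ‖S‖` and gives the identity of the scalar field norm `1`. -/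
structure BanachOperatorIdeal where
  /-- The operators from `X` to `Y` that belong to the ideal. -/
  ops (X Y : Type u) [NormedAddCommGroup X] [NormedSpace ℂ X] [CompleteSpace X]
    [NormedAddCommGroup Y] [NormedSpace ℂ Y] [CompleteSpace Y] : Submodule ℂ (X →L[ℂ] Y)
  /-- The ideal norm. -/
  norm (X Y : Type u) [NormedAddCommGroup X] [NormedSpace ℂ X] [CompleteSpace X]
    [NormedAddCommGroup Y] [NormedSpace ℂ Y] [CompleteSpace Y] : Seminorm ℂ (ops X Y)
  /-- Rank one operators, hence by linearity all finite rank operators, belong to the ideal. -/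
  smulRight_mem (X Y : Type u) [NormedAddCommGroup X] [NormedSpace ℂ X] [CompleteSpace X]
    [NormedAddCommGroup Y] [NormedSpace ℂ Y] [CompleteSpace Y] (φ : X →L[ℂ] ℂ) (y : Y) :
    φ.smulRight y ∈ ops X Y
  comp_mem (W X Y Z : Type u) [NormedAddCommGroup W] [NormedSpace ℂ W] [CompleteSpace W]
    [NormedAddCommGroup X] [NormedSpace ℂ X] [CompleteSpace X]
    [NormedAddCommGroup Y] [NormedSpace ℂ Y] [CompleteSpace Y]
    [NormedAddCommGroup Z] [NormedSpace ℂ Z] [CompleteSpace Z]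
    (S : W →L[ℂ] X) (T : X →L[ℂ] Y) (R : Y →L[ℂ] Z) (hT : T ∈ ops X Y) :
    R.comp (T.comp S) ∈ ops W Z
  norm_comp_le (W X Y Z : Type u) [NormedAddCommGroup W] [NormedSpace ℂ W] [CompleteSpace W]
    [NormedAddCommGroup X] [NormedSpace ℂ X] [CompleteSpace X]
    [NormedAddCommGroup Y] [NormedSpace ℂ Y] [CompleteSpace Y]
    [NormedAddCommGroup Z] [NormedSpace ℂ Z] [CompleteSpace Z]
    (S : W →L[ℂ] X) (T : X →L[ℂ] Y) (R : Y →L[ℂ] Z) (hT : T ∈ ops X Y) :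
    norm W Z ⟨R.comp (T.comp S), comp_mem W X Y Z S T R hT⟩ ≤ ‖R‖ * norm X Y ⟨T, hT⟩ * ‖S‖
  eq_zero_of_norm_eq_zero (X Y : Type u) [NormedAddCommGroup X] [NormedSpace ℂ X]
    [CompleteSpace X] [NormedAddCommGroup Y] [NormedSpace ℂ Y] [CompleteSpace Y] (T : ops X Y) :
    norm X Y T = 0 → T = 0
  /-- Every sequence that is Cauchy for the ideal norm converges for the ideal norm. -/
  complete (X Y : Type u) [NormedAddCommGroup X] [NormedSpace ℂ X]
    [CompleteSpace X] [NormedAddCommGroup Y] [NormedSpace ℂ Y] [CompleteSpace Y]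
    (T : ℕ → ops X Y) (hT : ∀ ε > 0, ∃ N, ∀ m ≥ N, ∀ n ≥ N, norm X Y (T m - T n) < ε) :
    ∃ S : ops X Y, Tendsto (fun n => norm X Y (T n - S)) atTop (𝓝 0)
  /-- `ULift ℂ` is the copy of the scalar field `ℂ` in the universe at hand; its identity is of
  finite rank, so the membership `h` always holds. -/
  norm_id (h : ContinuousLinearMap.id ℂ (ULift.{u} ℂ) ∈ ops (ULift.{u} ℂ) (ULift.{u} ℂ)) :
    norm (ULift.{u} ℂ) (ULift.{u} ℂ) ⟨ContinuousLinearMap.id ℂ (ULift.{u} ℂ), h⟩ = 1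

namespace BanachOperatorIdeal

/-- `K ⊆ X` is relatively `𝒜`-compact: `K ⊆ T(M)` for some Banach space `Z`, some `T ∈ 𝒜(Z; X)` and
some compact `M ⊆ Z`. -/
def RelCompact (𝒜 : BanachOperatorIdeal.{u}) {X : Type u} [NormedAddCommGroup X]
    [NormedSpace ℂ X] [CompleteSpace X] (K : Set X) : Prop :=
  ∃ (Z : Type u) (_ : NormedAddCommGroup Z) (_ : NormedSpace ℂ Z) (_ : CompleteSpace Z)
    (T : 𝒜.ops Z X) (M : Set Z), IsCompact M ∧ K ⊆ T.1 '' M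

/-- The size `m_𝒜(K, X)`: the infimum of `‖T‖_𝒜` over all `T ∈ 𝒜(Z; X)` such that `K ⊆ T(M)` for
some compact subset `M` of the open unit ball of `Z`. It is `∞` if `K` is not relatively
`𝒜`-compact. -/
noncomputable def size (𝒜 : BanachOperatorIdeal.{u}) {X : Type u} [NormedAddCommGroup X]
    [NormedSpace ℂ X] [CompleteSpace X] (K : Set X) : ℝ≥0∞ :=
  sInf {c | ∃ (Z : Type u) (_ : NormedAddCommGroup Z) (_ : NormedSpace ℂ Z) (_ : CompleteSpace Z)
    (T : 𝒜.ops Z X) (M : Set Z), IsCompact M ∧ M ⊆ ball 0 1 ∧ K ⊆ T.1 '' M ∧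
      c = ENNReal.ofReal (𝒜.norm Z X T)}

/-- A bounded operator is `𝒜`-compact if it maps the open unit ball to a relatively `𝒜`-compact
set. -/
def IsCompactOp (𝒜 : BanachOperatorIdeal.{u}) {Z X : Type u} [NormedAddCommGroup Z]
    [NormedSpace ℂ Z] [NormedAddCommGroup X] [NormedSpace ℂ X] [CompleteSpace X]
    (T : Z →L[ℂ] X) : Prop :=
  𝒜.RelCompact (T '' ball 0 1)

/-- The norm `‖T‖_{K_𝒜} = m_𝒜(T(B_Z), X)` of an `𝒜`-compact operator. -/
noncomputable def compactOpNorm (𝒜 : BanachOperatorIdeal.{u}) {Z X : Type u}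
    [NormedAddCommGroup Z] [NormedSpace ℂ Z] [NormedAddCommGroup X] [NormedSpace ℂ X]
    [CompleteSpace X] (T : Z →L[ℂ] X) : ℝ≥0∞ :=
  𝒜.size (T '' ball 0 1)

/-- The norm `‖P‖_{K_𝒜}` of a homogeneous polynomial `P : E → X`: the infimum of `‖T‖_{K_𝒜}` over
all Banach spaces `Z` and all `𝒜`-compact operators `T : Z → X` with `P(B_E) ⊆ T(B_Z)`. It is `∞`
if there is no such operator, that is, if `P` is not `𝒜`-compact. -/
noncomputable def polyNorm (𝒜 : BanachOperatorIdeal.{u}) {E : Type v} {X : Type u}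
    [NormedAddCommGroup E] [NormedSpace ℂ E]
    [NormedAddCommGroup X] [NormedSpace ℂ X] [CompleteSpace X] (P : E → X) : ℝ≥0∞ :=
  sInf {c | ∃ (Z : Type u) (_ : NormedAddCommGroup Z) (_ : NormedSpace ℂ Z) (_ : CompleteSpace Z)
    (T : Z →L[ℂ] X), 𝒜.IsCompactOp T ∧ P '' ball 0 1 ⊆ T '' ball 0 1 ∧ c = 𝒜.compactOpNorm T}

/-- `f` is `𝒜`-compact at `x`: some ball around `x` has a relatively `𝒜`-compact image. -/
def CompactAt (𝒜 : BanachOperatorIdeal.{u}) {E : Type v} {X : Type u}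
    [NormedAddCommGroup E] [NormedSpace ℂ E]
    [NormedAddCommGroup X] [NormedSpace ℂ X] [CompleteSpace X] (f : E → X) (x : E) : Prop :=
  ∃ ε > 0, 𝒜.RelCompact (f '' ball x ε)

end BanachOperatorIdeal

/-- The `n`-th homogeneous polynomial `P_n f(x₀)` of the Taylor series of `f` at `x₀`. -/
noncomputable def taylorPoly {E : Type v} {X : Type u} [NormedAddCommGroup E] [NormedSpace ℂ E]
    [NormedAddCommGroup X] [NormedSpace ℂ X] (f : E → X) (x₀ : E) (n : ℕ) (x : E) : X :=
  ((Nat.factorial n : ℕ) : ℂ)⁻¹ • iteratedFDeriv ℂ n f x₀ (fun _ => x)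

namespace BanachOperatorIdeal

open Classical in
/-- The radius of `𝒜`-compact convergence `r_{K_𝒜}(f, x₀) = 1 / limsup ‖P_n f(x₀)‖_{K_𝒜}^{1/n}`, with
value `0` if `f` is not `𝒜`-compact at `x₀`. -/
noncomputable def radius (𝒜 : BanachOperatorIdeal.{u}) {E : Type v} {X : Type u}
    [NormedAddCommGroup E] [NormedSpace ℂ E]
    [NormedAddCommGroup X] [NormedSpace ℂ X] [CompleteSpace X] (f : E → X) (x₀ : E) : ℝ≥0∞ :=
  if 𝒜.CompactAt f x₀ then
    (limsup (fun n : ℕ => 𝒜.polyNorm (taylorPoly f x₀ n) ^ (1 / (n : ℝ))) atTop)⁻¹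
  else 0

end BanachOperatorIdeal

/-- The complex Banach space `ℓ₁`. -/
abbrev EllOne : Type := lp (fun _ : ℕ => ℂ) 1

/-- The first vector of the canonical basis of `ℓ₁` (coordinates are indexed from `0`). -/
noncomputable def EllOne.e₁ : EllOne := lp.single 1 0 1

/-!
Let `T ∈ ℬ(Z; X)` map a compact set `M` to a set that is not relatively `𝒜`-compact. The point is
that finite subsets of `Z` can be small in norm and nevertheless have images under `T` that are large
for `𝒜`. Say that a set is dominated with constant `c` if it lies in the image of the closed unit
ball of a finite-dimensional space under an operator of `𝒜`-norm at most `c`. If the images of all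
finite subsets of some ball of `Z` were dominated with constant `1`, then, by homogeneity, the image
of a finite set would be dominated with a constant proportional to the size of the set. Decomposing
`M` into sums of series with terms in finite sets of geometrically decreasing size
(`IsCompact.exists_finite_hasSum`) and adding up the operators on the `ℓ₁`-sum of their domains
(`BanachOperatorIdeal.relCompact_of_hasSum`), one would find that `T(M)` is relatively `𝒜`-compact.
Hence for every `m` there are, after rescaling, finitely many vectors `y_{m,j}` in `Z` of norm at
most `1 / m!` such that the vectors `T y_{m,j}` are dominated with constant `2` but not with
constant `1`.

Split the coordinates of `ℓ₁` other than the first into disjoint blocks, let `u_m` map the basis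
vectors of the `m`-th block to the vectors `T y_{m,j}`, and put `f(a) = ∑ a₁ᵐ u_m(a)`.

* Since `‖u_m‖ ≤ ‖T‖ / m!`, the map is entire, and `f(a)` is the value at `a` of an entire
  operator-valued function of the single variable `a₁`. The same series with the vectors `y_{m,j}`
  maps bounded sets to relatively compact sets of `Z`, and `f` is its composition with `T`; so `f` is
  `ℬ`-compact.
* Where `|a₁| ≤ ρ < 1`, the terms of the series are dominated with constants `2 ρᵐ`, so `f` is
  `𝒜`-compact at every point of the open unit ball.
* Every ball around `e₁` contains points with first coordinate `s > 1` and one further coordinate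
  `t > 0` in the `m`-th block, where `f` takes the values `sᵐ t T y_{m,j}`. A single operator would
  have to dominate these for all `m`, which is impossible as `sᵐ t → ∞`.
* The Taylor polynomial of degree `m + 1` at `0` is `a₁ᵐ u_m(a)`. Its `𝒜`-compact norm is bounded
  above independently of `m`, and is at least `sᵐ t` whenever `s + t < 1`; so the radius is `1`.
-/

/-! ### Banach operator ideals: operator norm, restrictions, finite rank and series -/

namespace BanachOperatorIdeal

section Ideal

variable (𝒜 : BanachOperatorIdeal.{u})
  {W : Type u} [NormedAddCommGroup W] [NormedSpace ℂ W] [CompleteSpace W]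
  {Z : Type u} [NormedAddCommGroup Z] [NormedSpace ℂ Z] [CompleteSpace Z]
  {X : Type u} [NormedAddCommGroup X] [NormedSpace ℂ X] [CompleteSpace X]

theorem exists_comp_right (T : 𝒜.ops Z X) (S : W →L[ℂ] Z) :
    ∃ T' : 𝒜.ops W X, T'.1 = T.1.comp S ∧ 𝒜.norm W X T' ≤ 𝒜.norm Z X T * ‖S‖ := by
  have h := 𝒜.norm_comp_le W Z X X S T.1 (ContinuousLinearMap.id ℂ X) T.2
  refine ⟨⟨_, 𝒜.comp_mem W Z X X S T.1 (ContinuousLinearMap.id ℂ X) T.2⟩, rfl, h.trans ?_⟩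
  refine mul_le_mul_of_nonneg_right ?_ (norm_nonneg _)
  calc ‖ContinuousLinearMap.id ℂ X‖ * 𝒜.norm Z X T ≤ 1 * 𝒜.norm Z X T :=
        mul_le_mul_of_nonneg_right ContinuousLinearMap.norm_id_le (apply_nonneg _ _)
    _ = 𝒜.norm Z X T := one_mul _

/-- Composing with the scalar inclusion of `z` and a norming functional turns `T` into `‖T z‖` times
the identity of the scalar field, whose ideal norm is `1`; so the ideal norm dominates the operator
norm. -/
theorem norm_apply_le (T : 𝒜.ops Z X) (z : Z) : ‖T.1 z‖ ≤ 𝒜.norm Z X T * ‖z‖ := by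
  obtain ⟨g, hg1, hg2⟩ := exists_dual_vector'' ℂ (T.1 z)
  let e : ULift.{u} ℂ ≃ₗᵢ[ℂ] ℂ := LinearIsometryEquiv.ulift ℂ ℂ
  have he : ∀ c, e c = c.down := fun _ => rfl
  have he' : ∀ c, e.symm c = ULift.up c := fun _ => rfl
  let eL : ULift.{u} ℂ →L[ℂ] ℂ := e.toContinuousLinearEquiv
  let eR : ℂ →L[ℂ] ULift.{u} ℂ := e.symm.toContinuousLinearEquiv
  let S : ULift.{u} ℂ →L[ℂ] Z := eL.smulRight z
  let R : X →L[ℂ] ULift.{u} ℂ := eR.comp g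
  have hS : ‖S‖ ≤ ‖z‖ := by
    refine ContinuousLinearMap.opNorm_le_bound _ (norm_nonneg _) fun c => ?_
    have : ‖eL c‖ = ‖c‖ := e.norm_map c
    simp [S, norm_smul, this, mul_comm]
  have hR : ‖R‖ ≤ 1 := by
    refine ContinuousLinearMap.opNorm_le_bound _ zero_le_one fun x => ?_
    have : ‖eR (g x)‖ = ‖g x‖ := e.symm.norm_map _
    simp only [R, ContinuousLinearMap.comp_apply, this]
    exact (g.le_opNorm x).trans (mul_le_mul_of_nonneg_right hg1 (norm_nonneg _))
  have hid : ContinuousLinearMap.id ℂ (ULift.{u} ℂ) ∈ 𝒜.ops (ULift.{u} ℂ) (ULift.{u} ℂ) := by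
    have := 𝒜.smulRight_mem (ULift.{u} ℂ) (ULift.{u} ℂ) eL (ULift.up 1)
    convert this using 1
    ext c
    simp [eL, he]
  have key := 𝒜.norm_comp_le _ Z X _ S T.1 R T.2
  have heq : (⟨R.comp (T.1.comp S), 𝒜.comp_mem _ Z X _ S T.1 R T.2⟩ :
      𝒜.ops (ULift.{u} ℂ) (ULift.{u} ℂ)) = (‖T.1 z‖ : ℂ) • ⟨_, hid⟩ := by
    ext c
    simp [R, S, hg2, eL, eR, he, he', mul_comm]
  rw [heq, map_smul_eq_mul, 𝒜.norm_id hid, mul_one] at key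
  have h0 : (0 : ℝ) ≤ 𝒜.norm Z X T := apply_nonneg _ _
  have h1 : ‖((‖T.1 z‖ : ℝ) : ℂ)‖ = ‖T.1 z‖ := by simp
  calc ‖T.1 z‖ = ‖((‖T.1 z‖ : ℝ) : ℂ)‖ := h1.symm
    _ ≤ ‖R‖ * 𝒜.norm Z X T * ‖S‖ := key
    _ ≤ 1 * 𝒜.norm Z X T * ‖z‖ := by gcongr
    _ = _ := by ring

theorem mem_ops_of_finiteDimensional [FiniteDimensional ℂ W] (S : W →L[ℂ] X) :
    S ∈ 𝒜.ops W X := by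
  let b := Module.finBasis ℂ W
  have h : S = ∑ i, (LinearMap.toContinuousLinearMap (b.coord i)).smulRight (S (b i)) := by
    ext w
    conv_lhs => rw [← b.sum_repr w]
    rw [sum_apply, map_sum]
    simp
  rw [h]
  exact Submodule.sum_mem _ fun i _ => 𝒜.smulRight_mem _ _ _ _

/-- An absolutely summable series in the ideal norm converges pointwise to an operator of the
ideal. -/
theorem exists_tendsto_of_summable (T : ℕ → 𝒜.ops W X)
    (hT : Summable fun k => 𝒜.norm W X (T k)) :
    ∃ S : 𝒜.ops W X, ∀ w, Tendsto (fun n => ∑ k ∈ Finset.range n, (T k).1 w) atTop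
      (𝓝 (S.1 w)) := by
  let P : ℕ → 𝒜.ops W X := fun n => ∑ k ∈ Finset.range n, T k
  let Q : ℕ → ℝ := fun n => ∑ k ∈ Finset.range n, 𝒜.norm W X (T k)
  have hQ : CauchySeq Q := hT.hasSum.tendsto_sum_nat.cauchySeq
  have hmono : ∀ m n, m ≤ n → 𝒜.norm W X (P n - P m) ≤ Q n - Q m := by
    intro m n hmn
    have h1 : P n - P m = ∑ k ∈ Finset.Ico m n, T k := (Finset.sum_Ico_eq_sub _ hmn).symm
    have h2 : Q n - Q m = ∑ k ∈ Finset.Ico m n, 𝒜.norm W X (T k) :=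
      (Finset.sum_Ico_eq_sub _ hmn).symm
    rw [h1, h2]
    exact Finset.le_sum_of_subadditive _ (map_zero _).le (fun x y => map_add_le_add _ x y) _ _
  have hC : ∀ ε > 0, ∃ N, ∀ m ≥ N, ∀ n ≥ N, 𝒜.norm W X (P m - P n) < ε := by
    intro ε hε
    obtain ⟨N, hN⟩ := Metric.cauchySeq_iff.1 hQ ε hε
    refine ⟨N, fun m hm n hn => ?_⟩
    have hd := hN m hm n hn
    rw [Real.dist_eq, abs_lt] at hd
    rcases le_total n m with h | h
    · linarith [hmono n m h]
    · rw [map_sub_rev]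
      linarith [hmono m n h]
  obtain ⟨S, hS⟩ := 𝒜.complete W X P hC
  refine ⟨S, fun w => ?_⟩
  rw [tendsto_iff_norm_sub_tendsto_zero]
  have h0 : Tendsto (fun n => 𝒜.norm W X (P n - S) * ‖w‖) atTop (𝓝 0) := by
    simpa using hS.mul_const ‖w‖
  refine squeeze_zero (fun _ => norm_nonneg _) (fun n => ?_) h0
  have := 𝒜.norm_apply_le (P n - S) w
  simpa [P, sum_apply] using this

end Ideal

/-! ### Sets dominated by an operator with finite-dimensional domain -/

section Dominated

variable (𝒜 : BanachOperatorIdeal.{u})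
  {X : Type u} [NormedAddCommGroup X] [NormedSpace ℂ X] [CompleteSpace X]

/-- `K` is contained in the image of the closed unit ball of a finite-dimensional space under an
operator of ideal norm at most `c`. For finite sets this is a form of "`m_𝒜(K, X) ≤ c`" in which
the compact sets are simply closed balls. -/
def Dominated (c : ℝ) (K : Set X) : Prop :=
  ∃ (W : Type u) (_ : NormedAddCommGroup W) (_ : NormedSpace ℂ W) (_ : CompleteSpace W)
    (_ : FiniteDimensional ℂ W) (S : 𝒜.ops W X), 𝒜.norm W X S ≤ c ∧ K ⊆ S.1 '' closedBall 0 1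

variable {𝒜}

theorem Dominated.mono {c d : ℝ} {K L : Set X} (h : 𝒜.Dominated c K) (hcd : c ≤ d) (hLK : L ⊆ K) :
    𝒜.Dominated d L := by
  obtain ⟨W, _, _, _, _, S, h1, h2⟩ := h
  exact ⟨W, _, _, _, ‹_›, S, h1.trans hcd, hLK.trans h2⟩

theorem Dominated.smul {c : ℝ} {K L : Set X} (h : 𝒜.Dominated c K) (t : ℂ)
    (hL : ∀ x ∈ L, ∃ y ∈ K, x = t • y) : 𝒜.Dominated (‖t‖ * c) L := by
  obtain ⟨W, _, _, _, _, S, h1, h2⟩ := h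
  refine ⟨W, _, _, _, ‹_›, t • S, ?_, fun x hx => ?_⟩
  · rw [map_smul_eq_mul]
    exact mul_le_mul_of_nonneg_left h1 (norm_nonneg _)
  · obtain ⟨y, hy, rfl⟩ := hL x hx
    obtain ⟨w, hw, rfl⟩ := h2 hy
    exact ⟨w, hw, rfl⟩

/-- A finite set in the image of the unit ball is already in the image of the unit ball of the span
of finitely many preimages. -/
theorem dominated_of_finite {W : Type u} [NormedAddCommGroup W] [NormedSpace ℂ W]
    [CompleteSpace W] (S : 𝒜.ops W X) {K : Set X} (hK : K.Finite)
    (h : K ⊆ S.1 '' closedBall 0 1) : 𝒜.Dominated (𝒜.norm W X S) K := by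
  obtain ⟨F, hF, hFf, rfl⟩ : ∃ F ⊆ closedBall (0 : W) 1, F.Finite ∧ K = S.1 '' F :=
    Set.exists_subset_image_finite_and.1 ⟨K, h, hK, rfl⟩
  let V := Submodule.span ℂ F
  have : FiniteDimensional ℂ V := FiniteDimensional.span_of_finite ℂ hFf
  obtain ⟨S', hS', hn⟩ := 𝒜.exists_comp_right S V.subtypeL
  refine ⟨V, _, _, FiniteDimensional.complete ℂ V, this, S', hn.trans ?_, ?_⟩
  · exact mul_le_of_le_one_right (apply_nonneg _ _) V.norm_subtypeL_le
  · rintro _ ⟨w, hw, rfl⟩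
    refine ⟨⟨w, Submodule.subset_span hw⟩, ?_, by simp [hS']⟩
    simpa using hF hw

theorem exists_dominated_of_finite {K : Set X} (hK : K.Finite) : ∃ c, 𝒜.Dominated c K := by
  obtain ⟨C, hC⟩ := hK.isBounded.exists_norm_le
  let V := Submodule.span ℂ K
  have : FiniteDimensional ℂ V := FiniteDimensional.span_of_finite ℂ hK
  let C' : ℝ := max C 1
  have hC' : 0 < C' := lt_max_of_lt_right one_pos
  have : CompleteSpace V := FiniteDimensional.complete ℂ V
  refine ⟨_, V, _, _, ‹_›, ‹_›, ⟨(C' : ℂ) • V.subtypeL, 𝒜.mem_ops_of_finiteDimensional _⟩,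
    le_rfl, fun x hx => ⟨(C' : ℂ)⁻¹ • ⟨x, Submodule.subset_span hx⟩, ?_, ?_⟩⟩
  · have h1 : ‖x‖ ≤ C' := (hC x hx).trans (le_max_left _ _)
    have h2 : ‖(C' : ℂ)⁻¹‖ = C'⁻¹ := by
      rw [norm_inv, Complex.norm_real, Real.norm_of_nonneg hC'.le]
    rw [mem_closedBall_zero_iff, norm_smul, h2, inv_mul_le_iff₀ hC', mul_one]
    exact h1
  · have : (C' : ℂ) ≠ 0 := by exact_mod_cast hC'.ne'
    simp [this]

end Dominated

end BanachOperatorIdeal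

/-! ### Compact sets: sums of compact sets and telescoping nets -/

/-- The sums of series with terms in given compact sets form a compact set, provided that the sets
admit summable bounds: it is a continuous image of the product of the sets. -/
theorem isCompact_tsum_image {E : Type*} [NormedAddCommGroup E] [CompleteSpace E]
    {D : ℕ → Set E} (hD : ∀ k, IsCompact (D k)) {b : ℕ → ℝ} (hb : Summable b)
    (hDb : ∀ k, ∀ d ∈ D k, ‖d‖ ≤ b k) :
    IsCompact ((fun d : ℕ → E => ∑' k, d k) '' Set.univ.pi D) := by
  refine (isCompact_univ_pi hD).image_of_continuousOn ?_
  exact continuousOn_tsum (fun k => (continuous_apply k).continuousOn) hb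
    fun k d hd => hDb k _ (hd k trivial)

/-- Every point of a compact set is the sum of a series whose terms come from fixed finite sets of
geometrically decreasing size: the terms are the differences of successive approximations from
finite nets. -/
theorem IsCompact.exists_finite_hasSum {E : Type*} [NormedAddCommGroup E] [CompleteSpace E]
    {M : Set E} (hM : IsCompact M) :
    ∃ (C : ℝ) (F : ℕ → Set E), 0 < C ∧ (∀ k, (F k).Finite) ∧
      (∀ k, ∀ y ∈ F k, ‖y‖ ≤ C * (1 / 2) ^ k) ∧
      ∀ z ∈ M, ∃ y : ℕ → E, (∀ k, y k ∈ F k) ∧ HasSum y z := by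
  have hnet : ∀ k : ℕ, ∃ N : Set E, N.Finite ∧ ∀ z ∈ M, ∃ n ∈ N, ‖z - n‖ ≤ (1 / 2) ^ k := by
    intro k
    obtain ⟨N, -, hNf, hN⟩ := hM.finite_cover_balls (e := (1 / 2) ^ k) (by positivity)
    refine ⟨N, hNf, fun z hz => ?_⟩
    obtain ⟨n, hn, hzn⟩ := Set.mem_iUnion₂.1 (hN hz)
    exact ⟨n, hn, by rw [← dist_eq_norm]; exact (mem_ball.1 hzn).le⟩
  choose N hNf hN using hnet
  -- The first term of the series is an element of the first net, which is bounded by `C₀`; the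
  -- later ones are differences bounded by `2 * (1 / 2) ^ k = 4 * (1 / 2) ^ (k + 1)`.
  obtain ⟨C₀, hC₀⟩ := (hNf 0).isBounded.exists_norm_le
  let F : ℕ → Set E := fun k => Nat.casesOn k (N 0)
    fun k => {y ∈ Set.image2 (· - ·) (N (k + 1)) (N k) | ‖y‖ ≤ 2 * (1 / 2) ^ k}
  have hFb : ∀ k, ∀ y ∈ F k, ‖y‖ ≤ max C₀ 4 * (1 / 2) ^ k := by
    rintro (_ | k) y hy
    · simpa using Or.inl (hC₀ y hy)
    · calc ‖y‖ ≤ 2 * (1 / 2) ^ k := hy.2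
        _ = 4 * (1 / 2) ^ (k + 1) := by ring
        _ ≤ _ := by gcongr; exact le_max_right _ _
  refine ⟨max C₀ 4, F, by positivity, ?_, hFb, fun z hz => ?_⟩
  · rintro (_ | k)
    · exact hNf 0
    · exact ((hNf (k + 1)).image2 _ (hNf k)).subset fun y hy => hy.1
  · choose n hn hzn using fun k => hN k z hz
    let y : ℕ → E := fun k => Nat.casesOn k (n 0) fun k => n (k + 1) - n k
    have hy : ∀ k, y k ∈ F k := by
      rintro (_ | k)
      · exact hn 0
      · refine ⟨⟨n (k + 1), hn (k + 1), n k, hn k, rfl⟩, ?_⟩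
        calc ‖n (k + 1) - n k‖ = ‖(z - n k) - (z - n (k + 1))‖ := by congr 1; abel
          _ ≤ ‖z - n k‖ + ‖z - n (k + 1)‖ := norm_sub_le _ _
          _ ≤ (1 / 2) ^ k + (1 / 2) ^ (k + 1) := add_le_add (hzn k) (hzn (k + 1))
          _ ≤ 2 * (1 / 2) ^ k := by
            rw [pow_succ]; nlinarith [pow_pos (one_half_pos (α := ℝ)) k]
    refine ⟨y, hy, ?_⟩
    have hs : Summable y := by
      refine Summable.of_norm_bounded (g := fun k => max C₀ 4 * (1 / 2) ^ k) ?_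
        fun k => hFb k _ (hy k)
      exact (summable_geometric_of_lt_one (by norm_num) (by norm_num)).mul_left _
    refine (hs.hasSum_iff_tendsto_nat).2 ((tendsto_add_atTop_iff_nat 1).1 ?_)
    have hsum : ∀ k, ∑ i ∈ Finset.range (k + 1), y i = n k := by
      intro k
      induction k with
      | zero => simp [y]
      | succ k ih => rw [Finset.sum_range_succ, ih]; simp [y]
    simp only [hsum]
    rw [tendsto_iff_norm_sub_tendsto_zero]
    refine squeeze_zero (fun _ => norm_nonneg _) (fun k => ?_)
      (tendsto_pow_atTop_nhds_zero_of_lt_one (r := (1 / 2 : ℝ)) (by norm_num) (by norm_num))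
    rw [norm_sub_rev]
    exact hzn k

/-! ### Relatively compact sums of series -/

namespace BanachOperatorIdeal

section Sums

variable {𝒜 : BanachOperatorIdeal.{u}}
  {X : Type u} [NormedAddCommGroup X] [NormedSpace ℂ X] [CompleteSpace X]

/-- Sums of series with terms in sets of geometrically decreasing size form a relatively
`𝒜`-compact set. Writing the rate as `a ^ 2`, one factor `a ^ k` makes the operators summable on the
`ℓ₁`-sum of their domains, the other makes the relevant set of sequences in this `ℓ₁`-sum
compact. -/
theorem relCompact_of_hasSum {C r : ℝ} (hr0 : 0 < r) (hr1 : r < 1) {A : ℕ → Set X}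
    (hA : ∀ k, 𝒜.Dominated (C * r ^ k) (A k)) {K : Set X}
    (hK : ∀ x ∈ K, ∃ y : ℕ → X, (∀ k, y k ∈ A k) ∧ HasSum y x) : 𝒜.RelCompact K := by
  choose W i1 i2 i3 i4 S hSn hSA using hA
  obtain ⟨a, ha0, rfl⟩ : ∃ a : ℝ, 0 < a ∧ a ^ 2 = r := ⟨√r, Real.sqrt_pos.2 hr0,
    Real.sq_sqrt hr0.le⟩
  have ha1 : a < 1 := (sq_lt_one_iff₀ ha0.le).1 hr1
  have hgeo : Summable fun k : ℕ => a ^ k := summable_geometric_of_lt_one ha0.le ha1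
  have hproj : ∀ k, ‖lp.evalCLM ℂ W 1 k‖ ≤ 1 := fun k =>
    LinearMap.mkContinuous_norm_le _ zero_le_one _
  choose P hP hPn using fun k => 𝒜.exists_comp_right (S k) (lp.evalCLM ℂ W 1 k)
  let T : ℕ → 𝒜.ops (lp W 1) X := fun k => ((a : ℂ) ^ k)⁻¹ • P k
  have hT : Summable fun k => 𝒜.norm _ _ (T k) := by
    refine Summable.of_nonneg_of_le (fun _ => apply_nonneg _ _) (fun k => ?_) (hgeo.mul_left C)
    have h1 : ‖((a : ℂ) ^ k)⁻¹‖ = (a ^ k)⁻¹ := by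
      rw [norm_inv, norm_pow, Complex.norm_real, Real.norm_of_nonneg ha0.le]
    have h2 : 𝒜.norm _ _ (P k) ≤ C * (a ^ 2) ^ k :=
      ((hPn k).trans (mul_le_of_le_one_right (apply_nonneg _ _) (hproj k))).trans (hSn k)
    calc 𝒜.norm _ _ (T k) = (a ^ k)⁻¹ * 𝒜.norm _ _ (P k) := by
          rw [map_smul_eq_mul, h1]
      _ ≤ (a ^ k)⁻¹ * (C * (a ^ 2) ^ k) := by gcongr
      _ = C * a ^ k := by rw [← pow_mul, mul_comm 2 k, pow_mul]; field_simp
  obtain ⟨R, hR⟩ := 𝒜.exists_tendsto_of_summable T hT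
  let D : ℕ → Set (lp W 1) := fun k =>
    (fun w => lp.singleContinuousLinearMap ℂ W 1 k ((a : ℂ) ^ k • w)) '' closedBall 0 1
  have hDc : ∀ k, IsCompact (D k) := fun k => by
    have : ProperSpace (W k) := FiniteDimensional.proper ℂ (W k)
    exact (isCompact_closedBall _ _).image (by fun_prop)
  have hDb : ∀ k, ∀ d ∈ D k, ‖d‖ ≤ a ^ k := by
    rintro k _ ⟨w, hw, rfl⟩
    rw [mem_closedBall_zero_iff] at hw
    simp only [lp.singleContinuousLinearMap_apply]
    rw [lp.norm_single one_pos, norm_smul, norm_pow, Complex.norm_real,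
      Real.norm_of_nonneg ha0.le]
    exact mul_le_of_le_one_right (by positivity) hw
  refine ⟨lp W 1, _, _, inferInstance, R, _, isCompact_tsum_image hDc hgeo hDb, fun x hx => ?_⟩
  obtain ⟨y, hyA, hy⟩ := hK x hx
  choose w hw hwy using fun k => hSA k (hyA k)
  let d : ℕ → lp W 1 := fun k => lp.singleContinuousLinearMap ℂ W 1 k ((a : ℂ) ^ k • w k)
  have hd : ∀ k, d k ∈ D k := fun k => ⟨w k, hw k, rfl⟩
  refine ⟨∑' k, d k, ⟨d, fun k _ => hd k, rfl⟩, ?_⟩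
  have hds : Summable d := Summable.of_norm_bounded hgeo fun k => hDb k _ (hd k)
  have hcoord : ∀ k, lp.evalCLM ℂ W 1 k (∑' j, d j) = (a : ℂ) ^ k • w k := by
    intro k
    rw [ContinuousLinearMap.map_tsum _ hds, tsum_eq_single k]
    · exact lp.single_apply_self 1 k _
    · intro j hj
      exact lp.single_apply_ne 1 j _ hj.symm
  have hterm : ∀ k, (T k).1 (∑' j, d j) = y k := by
    intro k
    have hne : (a : ℂ) ^ k ≠ 0 := pow_ne_zero _ (by exact_mod_cast ha0.ne')
    have : (T k).1 = ((a : ℂ) ^ k)⁻¹ • (P k).1 := rfl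
    rw [this, smul_apply, hP k, ContinuousLinearMap.comp_apply, hcoord,
      map_smul, inv_smul_smul₀ hne, hwy]
  have h1 := hR (∑' j, d j)
  simp only [hterm] at h1
  exact tendsto_nhds_unique h1 hy.tendsto_sum_nat

end Sums

end BanachOperatorIdeal

/-! ### Small finite sets with large images -/

namespace BanachOperatorIdeal

section SmallSets

variable {𝒜 : BanachOperatorIdeal.{u}}
  {Z : Type u} [NormedAddCommGroup Z] [NormedSpace ℂ Z]
  {X : Type u} [NormedAddCommGroup X] [NormedSpace ℂ X] [CompleteSpace X]

/-- If `T` maps some compact set to a set that is not relatively `𝒜`-compact, then arbitrarily small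
finite sets have images that are not dominated by an operator of ideal norm `1`. Otherwise, by
homogeneity, the image of a finite set of size `s` would be dominated with a constant proportional
to `s`, and a decomposition of the compact set into series with terms in finite sets would show that
its image is relatively `𝒜`-compact. -/
theorem exists_finite_not_dominated_one [CompleteSpace Z] (T : Z →L[ℂ] X) {M : Set Z}
    (hM : IsCompact M) (hTM : ¬ 𝒜.RelCompact (T '' M)) {δ : ℝ} (hδ : 0 < δ) :
    ∃ F : Set Z, F.Finite ∧ (∀ y ∈ F, ‖y‖ ≤ δ) ∧ ¬ 𝒜.Dominated 1 (T '' F) := by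
  by_contra! hcon
  refine hTM ?_
  obtain ⟨C, F, hC, hFf, hFb, hFs⟩ := hM.exists_finite_hasSum
  have hA : ∀ k, 𝒜.Dominated (C / δ * (1 / 2) ^ k) (T '' F k) := by
    intro k
    let s : ℝ := C / δ * (1 / 2) ^ k
    have hs : 0 < s := by positivity
    have hsn : ‖(s : ℂ)‖ = s := by rw [Complex.norm_real, Real.norm_of_nonneg hs.le]
    have hsne : (s : ℂ) ≠ 0 := by exact_mod_cast hs.ne'
    have h1 : 𝒜.Dominated 1 (T '' ((fun y => (s : ℂ)⁻¹ • y) '' F k)) := by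
      refine hcon _ ((hFf k).image _) ?_
      rintro _ ⟨y, hy, rfl⟩
      simp only [norm_smul, norm_inv, hsn]
      rw [inv_mul_le_iff₀ hs]
      refine (hFb k y hy).trans (le_of_eq ?_)
      simp only [s]
      field_simp
    have h2 := h1.smul (L := T '' F k) (s : ℂ) ?_
    · rwa [hsn, mul_one] at h2
    · rintro _ ⟨y, hy, rfl⟩
      refine ⟨_, ⟨_, ⟨y, hy, rfl⟩, rfl⟩, ?_⟩
      simp only [map_smul]
      rw [smul_inv_smul₀ hsne]
  refine relCompact_of_hasSum (r := 1 / 2) (by norm_num) (by norm_num) hA ?_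
  rintro _ ⟨z, hz, rfl⟩
  obtain ⟨y, hyF, hy⟩ := hFs z hz
  exact ⟨fun k => T (y k), fun k => ⟨y k, hyF k, rfl⟩, hy.mapL T⟩

/-- Rescaling by a power of `2` normalizes a set that is not dominated with constant `1`. -/
theorem exists_scaled_dominated_two (T : Z →L[ℂ] X) {F : Set Z} (hF : F.Finite)
    (h1 : ¬ 𝒜.Dominated 1 (T '' F)) {δ : ℝ} (hδ : ∀ y ∈ F, ‖y‖ ≤ δ) :
    ∃ F' : Set Z, F'.Finite ∧ (∀ y ∈ F', ‖y‖ ≤ δ) ∧ 𝒜.Dominated 2 (T '' F') ∧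
      ¬ 𝒜.Dominated 1 (T '' F') := by
  classical
  have hex : ∃ k : ℕ, 𝒜.Dominated (2 ^ k) (T '' F) := by
    obtain ⟨c, hc⟩ := exists_dominated_of_finite (𝒜 := 𝒜) (hF.image T)
    obtain ⟨k, hk⟩ := pow_unbounded_of_one_lt c (one_lt_two (α := ℝ))
    exact ⟨k, hc.mono hk.le subset_rfl⟩
  obtain ⟨k, hk⟩ : ∃ k, Nat.find hex = k + 1 :=
    Nat.exists_eq_succ_of_ne_zero fun h => h1 (by simpa [h] using Nat.find_spec hex)
  have hd : 𝒜.Dominated (2 ^ (k + 1)) (T '' F) := hk ▸ Nat.find_spec hex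
  have hnd : ¬ 𝒜.Dominated (2 ^ k) (T '' F) := Nat.find_min hex (by omega)
  let t : ℂ := (2 ^ k)⁻¹
  have ht : t ≠ 0 := by simp [t]
  have htn : ‖t‖ = (2 ^ k)⁻¹ := by simp [t]
  have hp : (1 : ℝ) ≤ 2 ^ k := one_le_pow₀ one_le_two
  refine ⟨(fun y => t • y) '' F, hF.image _, ?_, ?_, fun h => hnd ?_⟩
  · rintro _ ⟨y, hy, rfl⟩
    simp only [norm_smul, htn]
    exact (mul_le_of_le_one_left (norm_nonneg _) (inv_le_one_of_one_le₀ hp)).trans (hδ y hy)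
  · have := hd.smul (L := T '' ((fun y => t • y) '' F)) t ?_
    · refine this.mono (le_of_eq ?_) subset_rfl
      rw [htn, pow_succ]
      field_simp
    · rintro _ ⟨_, ⟨y, hy, rfl⟩, rfl⟩
      exact ⟨T y, ⟨y, hy, rfl⟩, by simp⟩
  · have := h.smul (L := T '' F) t⁻¹ ?_
    · refine this.mono (le_of_eq ?_) subset_rfl
      rw [norm_inv, htn, inv_inv, mul_one]
    · rintro _ ⟨y, hy, rfl⟩
      refine ⟨_, ⟨_, ⟨y, hy, rfl⟩, rfl⟩, ?_⟩
      simp only [map_smul]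
      rw [inv_smul_smul₀ ht]

end SmallSets

end BanachOperatorIdeal

/-! ### Entire maps of the form `x ↦ ∑ φ(x)ᵐ uₘ(x)` -/

theorem hasFPowerSeriesOnBall_tsum_pow_smul {F : Type*} [NormedAddCommGroup F] [NormedSpace ℂ F]
    [CompleteSpace F] (c : ℕ → F) (hc : ∀ r : NNReal, Summable fun n => ‖c n‖ * (r : ℝ) ^ n) :
    HasFPowerSeriesOnBall (fun t : ℂ => ∑' n, t ^ n • c n)
      (fun n => ContinuousMultilinearMap.mkPiRing ℂ (Fin n) (c n)) 0 ⊤ := by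
  let p : FormalMultilinearSeries ℂ ℂ F :=
    fun n => ContinuousMultilinearMap.mkPiRing ℂ (Fin n) (c n)
  have hr : p.radius = ⊤ := p.radius_eq_top_of_summable_norm fun r => by
    simpa [p, ContinuousMultilinearMap.norm_mkPiRing] using hc r
  have h := p.hasFPowerSeriesOnBall (by rw [hr]; exact ENNReal.zero_lt_top)
  rw [hr] at h
  refine h.congr fun t _ => ?_
  simp [p, FormalMultilinearSeries.sum]

section Entire

variable {E : Type*} [NormedAddCommGroup E] [NormedSpace ℂ E]
  {F : Type*} [NormedAddCommGroup F] [NormedSpace ℂ F] [CompleteSpace F]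
  {φ : E →L[ℂ] ℂ} {u : ℕ → E →L[ℂ] F} {B : ℝ}

theorem summable_norm_mul_pow_of_le_div_factorial {G : Type*} [NormedAddCommGroup G] {c : ℕ → G}
    (hc : ∀ m, ‖c m‖ ≤ B / (m.factorial : ℝ)) (r : NNReal) :
    Summable fun m => ‖c m‖ * (r : ℝ) ^ m := by
  refine Summable.of_nonneg_of_le (fun _ => by positivity) (fun m => ?_)
    ((Real.summable_pow_div_factorial r).mul_left B)
  calc ‖c m‖ * (r : ℝ) ^ m ≤ B / (m.factorial : ℝ) * (r : ℝ) ^ m := by gcongr; exact hc m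
    _ = _ := by ring

theorem hasSum_pow_smul_clm (hu : ∀ m, ‖u m‖ ≤ B / (m.factorial : ℝ)) (t : ℂ) (x : E) :
    HasSum (fun m => t ^ m • u m x) ((∑' m, t ^ m • u m) x) := by
  have hs : Summable fun m => t ^ m • u m := by
    refine Summable.of_norm ?_
    simpa [norm_smul, mul_comm] using summable_norm_mul_pow_of_le_div_factorial hu ‖t‖₊
  exact hs.hasSum.mapL (ContinuousLinearMap.apply ℂ F x)

/-- The map is the entire operator-valued function `t ↦ ∑ tᵐ uₘ` of one variable at `t = φ(x)`,
applied to `x`. -/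
theorem analyticOnNhd_tsum_pow_smul_clm (hu : ∀ m, ‖u m‖ ≤ B / (m.factorial : ℝ)) :
    AnalyticOnNhd ℂ (fun x => ∑' m, φ x ^ m • u m x) Set.univ := by
  intro x _
  have hG := hasFPowerSeriesOnBall_tsum_pow_smul u (summable_norm_mul_pow_of_le_div_factorial hu)
  have h1 : AnalyticAt ℂ (fun x => ∑' m, φ x ^ m • u m) x :=
    (hG.analyticAt_of_mem (by simp)).fun_comp (φ.analyticAt x)
  have h2 : AnalyticAt ℂ (fun z => (∑' m, φ z ^ m • u m) z) x :=
    AnalyticAt.fun_comp (g := fun p : (E →L[ℂ] F) × E => p.1 p.2)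
      (f := fun z => (∑' m, φ z ^ m • u m, z))
      (ContinuousLinearMap.analyticAt_bilinear (ContinuousLinearMap.id ℂ (E →L[ℂ] F)) _)
      (h1.prod analyticAt_id)
  refine h2.congr (Eventually.of_forall fun z => ?_)
  exact (hasSum_pow_smul_clm hu (φ z) z).tsum_eq.symm

/-- The Taylor polynomials at `0` are read off from the restrictions to complex lines. -/
theorem taylorPoly_tsum_pow_smul_clm (hu : ∀ m, ‖u m‖ ≤ B / (m.factorial : ℝ)) (n : ℕ) (x : E) :
    taylorPoly (fun x => ∑' m, φ x ^ m • u m x) 0 (n + 1) x = φ x ^ n • u n x := by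
  let f : E → F := fun x => ∑' m, φ x ^ m • u m x
  let c : ℕ → F := fun k => Nat.casesOn k 0 fun m => φ x ^ m • u m x
  have hux : ∀ m, ‖u m x‖ ≤ (B * ‖x‖) / (m.factorial : ℝ) := fun m =>
    ((u m).le_of_opNorm_le (hu m) x).trans (le_of_eq (by ring))
  have hc : ∀ r : NNReal, Summable fun k => ‖c k‖ * (r : ℝ) ^ k := by
    intro r
    refine (summable_nat_add_iff 1).1 ?_
    refine ((summable_norm_mul_pow_of_le_div_factorial hux (‖φ x‖₊ * r)).mul_left (r : ℝ)).congr
      fun m => ?_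
    simp only [c, norm_smul, norm_pow, NNReal.coe_mul, coe_nnnorm]
    ring
  have hline : f ∘ (ContinuousLinearMap.toSpanSingleton ℂ x) = fun t : ℂ => ∑' k, t ^ k • c k := by
    funext t
    have hs : Summable fun k => t ^ k • c k := by
      refine Summable.of_norm ?_
      simpa [norm_smul, mul_comm] using hc ‖t‖₊
    have h0 : t ^ 0 • c 0 = 0 := smul_zero _
    rw [hs.tsum_eq_zero_add, h0, zero_add]
    simp only [f, c, Function.comp_apply, ContinuousLinearMap.toSpanSingleton_apply, map_smul,
      smul_eq_mul]
    refine tsum_congr fun m => ?_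
    rw [smul_smul, smul_smul]
    congr 1
    ring
  have hp := hasFPowerSeriesOnBall_tsum_pow_smul c hc
  rw [← hline] at hp
  have h1 := hp.factorial_smul 1 (n + 1)
  have hcd : ContDiff ℂ ⊤ f := by
    exact (analyticOnNhd_tsum_pow_smul_clm hu).contDiff
  rw [ContinuousLinearMap.iteratedFDeriv_comp_right _ hcd 0 le_top] at h1
  simp only [ContinuousMultilinearMap.compContinuousLinearMap_apply, map_zero,
    ContinuousLinearMap.toSpanSingleton_apply, one_smul] at h1
  have h2 : iteratedFDeriv ℂ (n + 1) f 0 (fun _ => x) =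
      ((n + 1).factorial : ℂ) • (φ x ^ n • u n x) := by
    rw [← h1, Nat.cast_smul_eq_nsmul]
    simp [c]
  have h3 : taylorPoly f 0 (n + 1) x = (((n + 1).factorial : ℕ) : ℂ)⁻¹ •
      iteratedFDeriv ℂ (n + 1) f 0 (fun _ => x) := rfl
  have hne : ((n + 1).factorial : ℂ) ≠ 0 := by exact_mod_cast (n + 1).factorial_ne_zero
  change taylorPoly f 0 (n + 1) x = _
  rw [h3, h2, inv_smul_smul₀ hne]

end Entire

/-! ### Block sums on `ℓ₁` -/

namespace EllOne

theorem sum_norm_apply_le {ι : Type*} [Fintype ι] {g : ι → ℕ} (hg : Function.Injective g)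
    (a : EllOne) : ∑ i, ‖a (g i)‖ ≤ ‖a‖ := by
  have h := lp.sum_rpow_le_norm_rpow (p := 1) (by simp) a (Finset.univ.map ⟨g, hg⟩)
  simpa using h

/-- The coordinates of the `m`-th block. The blocks for different `m` are disjoint, and none of them
contains the coordinate `0`. -/
def slot (m j : ℕ) : ℕ := Nat.pair m j + 1

theorem slot_inj {m j m' j' : ℕ} : slot m j = slot m' j' ↔ m = m' ∧ j = j' := by
  simp [slot, Nat.pair_eq_pair]

section Block

variable {Z : Type*} [NormedAddCommGroup Z] [NormedSpace ℂ Z] {n : ℕ}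

/-- The operator on `ℓ₁` that maps the basis vectors of the `m`-th block to the given vectors, and
the other basis vectors to `0`. -/
noncomputable def block (m : ℕ) (y : Fin n → Z) : EllOne →L[ℂ] Z :=
  ∑ j : Fin n, (lp.evalCLM ℂ (fun _ : ℕ => ℂ) 1 (slot m j)).smulRight (y j)

theorem block_apply (m : ℕ) (y : Fin n → Z) (a : EllOne) :
    block m y a = ∑ j : Fin n, a (slot m j) • y j := by
  rw [block, sum_apply]
  rfl

theorem sum_norm_slot_le (m : ℕ) (a : EllOne) : ∑ j : Fin n, ‖a (slot m j)‖ ≤ ‖a‖ :=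
  sum_norm_apply_le (fun _ _ h => Fin.ext (slot_inj.1 h).2) a

theorem norm_sum_slot_le {δ : ℝ} (m : ℕ) {y : Fin n → Z} (hδ : 0 ≤ δ) (hy : ∀ j, ‖y j‖ ≤ δ)
    (a : EllOne) : ‖∑ j : Fin n, a (slot m j) • y j‖ ≤ δ * ‖a‖ := by
  calc ‖∑ j : Fin n, a (slot m j) • y j‖ ≤ ∑ j : Fin n, ‖a (slot m j)‖ * δ :=
        norm_sum_le_of_le _ fun j _ => by
          rw [norm_smul]
          exact mul_le_mul_of_nonneg_left (hy j) (norm_nonneg _)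
    _ = δ * ∑ j : Fin n, ‖a (slot m j)‖ := by rw [← Finset.sum_mul, mul_comm]
    _ ≤ δ * ‖a‖ := mul_le_mul_of_nonneg_left (sum_norm_slot_le m a) hδ

theorem norm_block_le {δ : ℝ} (m : ℕ) {y : Fin n → Z} (hδ : 0 ≤ δ) (hy : ∀ j, ‖y j‖ ≤ δ) :
    ‖block m y‖ ≤ δ :=
  ContinuousLinearMap.opNorm_le_bound _ hδ fun a => by
    rw [block_apply]
    exact norm_sum_slot_le m hδ hy a

theorem map_block {X : Type*} [NormedAddCommGroup X] [NormedSpace ℂ X] (T : Z →L[ℂ] X) (m : ℕ)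
    (y : Fin n → Z) (a : EllOne) : T (block m y a) = block m (fun j => T (y j)) a := by
  simp [block_apply]

theorem exists_isCompact_block {δ : ℝ} (m : ℕ) {y : Fin n → Z} (hδ : 0 ≤ δ)
    (hy : ∀ j, ‖y j‖ ≤ δ) :
    ∃ D : Set Z, IsCompact D ∧ (∀ d ∈ D, ‖d‖ ≤ δ) ∧ block m y '' closedBall 0 1 ⊆ D := by
  let g : (Fin n → ℂ) → Z := fun α => ∑ j, α j • y j
  have hg : Continuous g := by fun_prop
  refine ⟨g '' closedBall 0 1 ∩ closedBall 0 δ,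
    ((isCompact_closedBall _ _).image hg).inter_right isClosed_closedBall,
    fun d hd => by simpa using hd.2, ?_⟩
  rintro _ ⟨a, ha, rfl⟩
  rw [mem_closedBall_zero_iff] at ha
  refine ⟨⟨fun j => a (slot m j), ?_, (block_apply m y a).symm⟩, ?_⟩
  · rw [mem_closedBall_zero_iff, pi_norm_le_iff_of_nonneg zero_le_one]
    exact fun j => (lp.norm_apply_le_norm one_ne_zero a _).trans ha
  · rw [mem_closedBall_zero_iff, block_apply]
    exact (norm_sum_slot_le m hδ hy a).trans (mul_le_of_le_one_right hδ ha)

/-- The vector `s e₁ + t e_k`, where `k` is the `j`-th coordinate of the `m`-th block. -/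
noncomputable def twoPoint (m j : ℕ) (s t : ℂ) : EllOne :=
  lp.single 1 0 s + lp.single 1 (slot m j) t

theorem twoPoint_zero (m j : ℕ) (s t : ℂ) : twoPoint m j s t 0 = s := by
  simp [twoPoint, slot, lp.single_apply]

theorem twoPoint_slot (m j k i : ℕ) (s t : ℂ) :
    twoPoint m j s t (slot k i) = if k = m ∧ i = j then t else 0 := by
  have h0 : slot k i ≠ 0 := Nat.succ_ne_zero _
  simp [twoPoint, lp.single_apply, Pi.single_apply, h0, slot_inj]

theorem norm_twoPoint_le (m j : ℕ) (s t : ℂ) : ‖twoPoint m j s t‖ ≤ ‖s‖ + ‖t‖ := by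
  refine (norm_add_le _ _).trans (le_of_eq ?_)
  rw [lp.norm_single one_pos, lp.norm_single one_pos]

theorem block_twoPoint (m : ℕ) (y : Fin n → Z) (j : Fin n) (s t : ℂ) :
    block m y (twoPoint m j s t) = t • y j := by
  rw [block_apply, Finset.sum_eq_single j]
  · simp [twoPoint_slot]
  · intro i _ hij
    have : (i : ℕ) ≠ j := fun h => hij (Fin.ext h)
    simp [twoPoint_slot, this]
  · simp

theorem block_twoPoint_of_ne {m k : ℕ} (hkm : k ≠ m) (y : Fin n → Z) (j : ℕ) (s t : ℂ) :
    block k y (twoPoint m j s t) = 0 := by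
  simp [block_apply, twoPoint_slot, hkm]

end Block

/-! ### The series of block sums -/

section BlockSeries

variable {N : ℕ → ℕ}

/-- The map `a ↦ ∑ a₁ᵐ uₘ(a)`, where `a₁` is the first coordinate (with index `0`) and `uₘ` is the
block operator with values `y m`. -/
noncomputable def blockSeries {Z : Type*} [NormedAddCommGroup Z] [NormedSpace ℂ Z]
    (y : ∀ m, Fin (N m) → Z) (a : EllOne) : Z :=
  ∑' m, a 0 ^ m • block m (y m) a

variable {Z : Type*} [NormedAddCommGroup Z] [NormedSpace ℂ Z]
  {y : ∀ m, Fin (N m) → Z} {B : ℝ}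

theorem norm_block_le_div_factorial (hB : 0 ≤ B) (hy : ∀ m j, ‖y m j‖ ≤ B / (m.factorial : ℝ))
    (m : ℕ) : ‖block m (y m)‖ ≤ B / (m.factorial : ℝ) :=
  norm_block_le m (by positivity) (hy m)

theorem blockSeries_twoPoint (y : ∀ m, Fin (N m) → Z) (m : ℕ) (j : Fin (N m)) (s t : ℂ) :
    blockSeries y (twoPoint m j s t) = (s ^ m * t) • y m j := by
  rw [blockSeries, tsum_eq_single m, twoPoint_zero, block_twoPoint, smul_smul]
  intro k hk
  rw [block_twoPoint_of_ne hk, smul_zero]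

/-- Since `|a₁| ≤ ‖a‖`, on the ball of radius `R` the `m`-th term of the series takes no other values
than `Rᵐ` times those of the block operator. -/
theorem pow_smul_block_eq {R : ℝ} (hR : 0 < R) {a : EllOne} (ha : ‖a‖ ≤ R) (m : ℕ) :
    ∃ b : EllOne, ‖b‖ ≤ ‖a‖ ∧ a 0 ^ m • block m (y m) a = (R : ℂ) ^ m • block m (y m) b := by
  have hne : (R : ℂ) ≠ 0 := by exact_mod_cast hR.ne'
  refine ⟨(a 0 / R) ^ m • a, ?_, ?_⟩
  · have h1 : ‖a 0 / (R : ℂ)‖ ≤ 1 := by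
      rw [norm_div, Complex.norm_real, Real.norm_of_nonneg hR.le, div_le_one hR]
      exact (lp.norm_apply_le_norm one_ne_zero a 0).trans ha
    rw [norm_smul, norm_pow]
    exact mul_le_of_le_one_left (norm_nonneg _) (pow_le_one₀ (norm_nonneg _) h1)
  · rw [map_smul, smul_smul, ← mul_pow, mul_div_cancel₀ _ hne]

variable [CompleteSpace Z]

theorem hasSum_blockSeries (hB : 0 ≤ B) (hy : ∀ m j, ‖y m j‖ ≤ B / (m.factorial : ℝ))
    (a : EllOne) : HasSum (fun m => a 0 ^ m • block m (y m) a) (blockSeries y a) :=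
  (hasSum_pow_smul_clm (norm_block_le_div_factorial hB hy) (a 0) a).summable.hasSum

theorem analyticOnNhd_blockSeries (hB : 0 ≤ B) (hy : ∀ m j, ‖y m j‖ ≤ B / (m.factorial : ℝ)) :
    AnalyticOnNhd ℂ (blockSeries y) Set.univ :=
  analyticOnNhd_tsum_pow_smul_clm (φ := lp.evalCLM ℂ (fun _ : ℕ => ℂ) 1 0)
    (norm_block_le_div_factorial hB hy)

theorem taylorPoly_blockSeries (hB : 0 ≤ B) (hy : ∀ m j, ‖y m j‖ ≤ B / (m.factorial : ℝ)) (m : ℕ)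
    (a : EllOne) : taylorPoly (blockSeries y) 0 (m + 1) a = a 0 ^ m • block m (y m) a :=
  taylorPoly_tsum_pow_smul_clm (φ := lp.evalCLM ℂ (fun _ : ℕ => ℂ) 1 0)
    (norm_block_le_div_factorial hB hy) m a

theorem map_blockSeries {X : Type*} [NormedAddCommGroup X] [NormedSpace ℂ X] (T : Z →L[ℂ] X)
    (hB : 0 ≤ B) (hy : ∀ m j, ‖y m j‖ ≤ B / (m.factorial : ℝ)) (a : EllOne) :
    T (blockSeries y a) = blockSeries (fun m j => T (y m j)) a := by
  rw [← ((hasSum_blockSeries hB hy a).mapL T).tsum_eq, blockSeries]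
  simp [map_block]

theorem exists_isCompact_blockSeries (hB : 0 ≤ B)
    (hy : ∀ m j, ‖y m j‖ ≤ B / (m.factorial : ℝ)) {R : ℝ} (hR : 0 < R) :
    ∃ M : Set Z, IsCompact M ∧ blockSeries y '' closedBall 0 R ⊆ M := by
  choose D hDc hDb hD using fun m =>
    exists_isCompact_block (y := y m) m (by positivity : 0 ≤ B / (m.factorial : ℝ)) (hy m)
  have hRn : ‖(R : ℂ)‖ = R := by rw [Complex.norm_real, Real.norm_of_nonneg hR.le]
  have hne : (R : ℂ) ≠ 0 := by exact_mod_cast hR.ne'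
  refine ⟨_, isCompact_tsum_image (D := fun m => (fun z => (R : ℂ) ^ (m + 1) • z) '' D m)
    (fun m => (hDc m).image (by fun_prop))
    (b := fun m => (R * B) * (R ^ m / (m.factorial : ℝ)))
    ((Real.summable_pow_div_factorial R).mul_left _) ?_, ?_⟩
  · rintro m _ ⟨z, hz, rfl⟩
    simp only [norm_smul, norm_pow, hRn]
    calc R ^ (m + 1) * ‖z‖ ≤ R ^ (m + 1) * (B / (m.factorial : ℝ)) := by
          gcongr; exact hDb m z hz
      _ = _ := by ring
  · rintro _ ⟨a, ha, rfl⟩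
    rw [mem_closedBall_zero_iff] at ha
    refine ⟨fun m => a 0 ^ m • block m (y m) a, fun m _ => ?_, rfl⟩
    obtain ⟨b, hb, hab⟩ := pow_smul_block_eq (y := y) hR ha m
    refine ⟨block m (y m) ((R : ℂ)⁻¹ • b), hD m ⟨_, ?_, rfl⟩, ?_⟩
    · rw [mem_closedBall_zero_iff, norm_smul, norm_inv, hRn, inv_mul_le_iff₀ hR, mul_one]
      exact hb.trans ha
    · simp only [hab, map_smul, pow_succ, mul_smul]
      rw [smul_inv_smul₀ hne]

end BlockSeries

end EllOne

/-! ### Compactness and radius of the block series -/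

namespace BanachOperatorIdeal

open EllOne

variable {𝒜 : BanachOperatorIdeal.{u}}
  {X : Type u} [NormedAddCommGroup X] [NormedSpace ℂ X] [CompleteSpace X]

theorem dominated_of_smul_mem {W : Type u} [NormedAddCommGroup W] [NormedSpace ℂ W]
    [CompleteSpace W] (S : 𝒜.ops W X) {K : Set X} (hK : K.Finite) {p r : ℝ} (hp : 0 < p)
    (hr : 0 < r) (h : ∀ x ∈ K, (p : ℂ) • x ∈ S.1 '' closedBall 0 r) :
    𝒜.Dominated (r / p * 𝒜.norm W X S) K := by
  have hpne : (p : ℂ) ≠ 0 := by exact_mod_cast hp.ne'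
  have hrne : (r : ℂ) ≠ 0 := by exact_mod_cast hr.ne'
  have h1 : 𝒜.norm W X (((r / p : ℝ) : ℂ) • S) = r / p * 𝒜.norm W X S := by
    rw [map_smul_eq_mul, Complex.norm_real, Real.norm_of_nonneg (by positivity)]
  rw [← h1]
  refine dominated_of_finite _ hK fun x hx => ?_
  obtain ⟨w, hw, hwx⟩ := h x hx
  refine ⟨(r : ℂ)⁻¹ • w, ?_, ?_⟩
  · rw [mem_closedBall_zero_iff] at hw ⊢
    rwa [norm_smul, norm_inv, Complex.norm_real, Real.norm_of_nonneg hr.le, inv_mul_le_iff₀ hr,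
      mul_one]
  · change ((r / p : ℝ) : ℂ) • S.1 ((r : ℂ)⁻¹ • w) = x
    rw [map_smul, hwx, smul_smul, smul_smul]
    push_cast
    rw [show (r : ℂ) / p * (r : ℂ)⁻¹ * p = 1 by field_simp, one_smul]

theorem Dominated.block {c : ℝ} {n : ℕ} {x : Fin n → X} (h : 𝒜.Dominated c (Set.range x)) (m : ℕ) :
    𝒜.Dominated c (EllOne.block m x '' closedBall 0 1) := by
  obtain ⟨W, _, _, _, hfd, S, h1, h2⟩ := h
  refine ⟨W, _, _, _, hfd, S, h1, ?_⟩
  choose w hw hwx using fun j => h2 (Set.mem_range_self j)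
  rintro _ ⟨a, ha, rfl⟩
  refine ⟨EllOne.block m w a, ?_, ?_⟩
  · rw [mem_closedBall_zero_iff] at ha ⊢
    rw [block_apply]
    refine (norm_sum_slot_le m zero_le_one (fun j => by simpa using hw j) a).trans ?_
    rwa [one_mul]
  · rw [map_block]
    simp only [hwx]

theorem isCompactOp_of_finiteDimensional {W : Type u} [NormedAddCommGroup W] [NormedSpace ℂ W]
    [CompleteSpace W] [FiniteDimensional ℂ W] (S : 𝒜.ops W X) : 𝒜.IsCompactOp S.1 := by
  have : ProperSpace W := FiniteDimensional.proper ℂ W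
  exact ⟨W, _, _, ‹_›, S, closedBall 0 1, isCompact_closedBall _ _,
    Set.image_mono ball_subset_closedBall⟩

/-- The factor `2` lets the compact set be the closed ball of radius `1 / 2`, which lies in the open
unit ball. -/
theorem compactOpNorm_le {W : Type u} [NormedAddCommGroup W] [NormedSpace ℂ W]
    [CompleteSpace W] [FiniteDimensional ℂ W] (S : 𝒜.ops W X) :
    𝒜.compactOpNorm S.1 ≤ ENNReal.ofReal (2 * 𝒜.norm W X S) := by
  have : ProperSpace W := FiniteDimensional.proper ℂ W
  have h2 : 𝒜.norm W X ((2 : ℂ) • S) = 2 * 𝒜.norm W X S := by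
    rw [map_smul_eq_mul, Complex.norm_ofNat]
  rw [← h2]
  refine sInf_le ⟨W, _, _, ‹_›, (2 : ℂ) • S, closedBall 0 (1 / 2), isCompact_closedBall _ _,
    closedBall_subset_ball (by norm_num), ?_, rfl⟩
  rintro _ ⟨w, hw, rfl⟩
  rw [mem_ball_zero_iff] at hw
  refine ⟨(2 : ℂ)⁻¹ • w, ?_, ?_⟩
  · rw [mem_closedBall_zero_iff, norm_smul, norm_inv, Complex.norm_ofNat]
    linarith
  · change (2 : ℂ) • S.1 ((2 : ℂ)⁻¹ • w) = _
    rw [map_smul, smul_inv_smul₀ two_ne_zero]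

section BlockSeries

variable {N : ℕ → ℕ} {x : ∀ m, Fin (N m) → X} {B C : ℝ}

theorem compactAt_blockSeries_of_mem_ball (hB : 0 ≤ B)
    (hx : ∀ m j, ‖x m j‖ ≤ B / (m.factorial : ℝ))
    (hC : ∀ m, 𝒜.Dominated C (Set.range (x m))) {a : EllOne} (ha : a ∈ ball (0 : EllOne) 1) :
    𝒜.CompactAt (blockSeries x) a := by
  rw [mem_ball_zero_iff] at ha
  obtain ⟨ρ, hρa, hρ1⟩ := exists_between ha
  have hρ0 : 0 < ρ := (norm_nonneg a).trans_lt hρa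
  have hρn : ‖(ρ : ℂ)‖ = ρ := by rw [Complex.norm_real, Real.norm_of_nonneg hρ0.le]
  refine ⟨ρ - ‖a‖, sub_pos.2 hρa, ?_⟩
  refine relCompact_of_hasSum (C := C) hρ0 hρ1
    (A := fun m => (fun z => (ρ : ℂ) ^ m • z) '' (EllOne.block m (x m) '' closedBall 0 1))
    (fun m => ?_) ?_
  · have h := ((hC m).block m).smul (L := (fun z => (ρ : ℂ) ^ m • z) ''
      (EllOne.block m (x m) '' closedBall 0 1)) ((ρ : ℂ) ^ m) ?_
    · rwa [norm_pow, hρn, mul_comm] at h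
    · rintro _ ⟨z, hz, rfl⟩
      exact ⟨z, hz, rfl⟩
  · rintro _ ⟨b, hb, rfl⟩
    have hbρ : ‖b‖ ≤ ρ := by
      have h1 : ‖b - a‖ < ρ - ‖a‖ := by rwa [← mem_ball_iff_norm]
      linarith [norm_le_norm_add_norm_sub' b a]
    refine ⟨_, fun m => ?_, hasSum_blockSeries hB hx b⟩
    obtain ⟨d, hd, hbd⟩ := pow_smul_block_eq (y := x) hρ0 hbρ m
    rw [hbd]
    exact ⟨_, ⟨d, by simpa using hd.trans (hbρ.trans hρ1.le), rfl⟩, rfl⟩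

/-- Near `e₁` the first coordinate takes a value `s > 1`, so a neighbourhood of `e₁` is mapped onto
a set containing a small multiple of `sᵐ` times the values of the `m`-th block. These multiples grow
without bound, so no single operator can dominate all of them. -/
theorem not_compactAt_blockSeries_e₁ (hx : ∀ m, ¬ 𝒜.Dominated 1 (Set.range (x m))) :
    ¬ 𝒜.CompactAt (blockSeries x) e₁ := by
  rintro ⟨ε, hε, Z, _, _, _, S, M, hM, hS⟩
  obtain ⟨r, hr, hMr⟩ := hM.isBounded.exists_pos_norm_le
  let s : ℝ := 1 + ε / 2
  let t : ℝ := ε / 3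
  have ht : 0 < t := by positivity
  have hs : 1 < s := by simp only [s]; linarith
  obtain ⟨m, hm⟩ := pow_unbounded_of_one_lt (r * 𝒜.norm Z X S / t) hs
  have hp : 0 < s ^ m * t := by positivity
  refine hx m ((dominated_of_smul_mem S (Set.finite_range _) hp hr ?_).mono ?_ subset_rfl)
  · rintro _ ⟨j, rfl⟩
    have hmem : twoPoint m j (s : ℂ) (t : ℂ) ∈ ball e₁ ε := by
      have hsub : twoPoint m j (s : ℂ) (t : ℂ) - e₁ =
          twoPoint m j ((ε / 2 : ℝ) : ℂ) (t : ℂ) := by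
        have : (s : ℂ) = 1 + ((ε / 2 : ℝ) : ℂ) := by simp [s]
        rw [this, twoPoint, twoPoint, lp.single_add, e₁]
        abel
      rw [mem_ball_iff_norm, hsub]
      refine (norm_twoPoint_le _ _ _ _).trans_lt ?_
      rw [Complex.norm_real, Complex.norm_real, Real.norm_of_nonneg (by positivity),
        Real.norm_of_nonneg ht.le]
      simp only [t]
      linarith
    obtain ⟨w, hw, hwx⟩ := hS ⟨_, hmem, rfl⟩
    rw [blockSeries_twoPoint] at hwx
    refine ⟨w, by simpa using hMr w hw, ?_⟩
    rw [hwx]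
    push_cast
    rfl
  · rw [div_mul_eq_mul_div, div_le_one hp]
    rw [div_lt_iff₀ ht] at hm
    exact hm.le

theorem polyNorm_taylorPoly_blockSeries_le (hB : 0 ≤ B)
    (hx : ∀ m j, ‖x m j‖ ≤ B / (m.factorial : ℝ)) {m : ℕ}
    (hC : 𝒜.Dominated C (Set.range (x m))) :
    𝒜.polyNorm (taylorPoly (blockSeries x) 0 (m + 1)) ≤ ENNReal.ofReal (4 * C) := by
  obtain ⟨W, _, _, _, _, S, hSC, hS⟩ := hC.block m
  -- The factor `2` leaves room to pass from the closed to the open unit ball of `W`.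
  let R : 𝒜.ops W X := (2 : ℂ) • S
  have hR : 𝒜.norm W X R = 2 * 𝒜.norm W X S := by rw [map_smul_eq_mul, Complex.norm_ofNat]
  have hsub : taylorPoly (blockSeries x) 0 (m + 1) '' ball 0 1 ⊆ R.1 '' ball 0 1 := by
    rintro _ ⟨a, ha, rfl⟩
    rw [mem_ball_zero_iff] at ha
    obtain ⟨b, hb, hab⟩ := pow_smul_block_eq (y := x) one_pos ha.le m
    obtain ⟨w, hw, hwb⟩ := hS ⟨b, by simpa using hb.trans ha.le, rfl⟩
    rw [mem_closedBall_zero_iff] at hw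
    refine ⟨(2 : ℂ)⁻¹ • w, ?_, ?_⟩
    · rw [mem_ball_zero_iff, norm_smul, norm_inv, Complex.norm_ofNat]
      linarith
    · rw [taylorPoly_blockSeries hB hx, hab]
      change (2 : ℂ) • S.1 ((2 : ℂ)⁻¹ • w) = _
      rw [map_smul, smul_inv_smul₀ two_ne_zero, hwb]
      simp
  have hle : 𝒜.compactOpNorm R.1 ≤ ENNReal.ofReal (4 * C) := by
    refine (compactOpNorm_le R).trans (ENNReal.ofReal_le_ofReal ?_)
    linarith
  refine le_trans (sInf_le ?_) hle
  exact ⟨W, _, _, ‹_›, R.1, isCompactOp_of_finiteDimensional R, hsub, rfl⟩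

theorem le_polyNorm_taylorPoly_blockSeries (hB : 0 ≤ B)
    (hx : ∀ m j, ‖x m j‖ ≤ B / (m.factorial : ℝ)) {m : ℕ}
    (hx1 : ¬ 𝒜.Dominated 1 (Set.range (x m))) {s t : ℝ} (hs : 0 < s) (ht : 0 < t)
    (hst : s + t < 1) :
    ENNReal.ofReal (s ^ m * t) ≤ 𝒜.polyNorm (taylorPoly (blockSeries x) 0 (m + 1)) := by
  have hp : 0 < s ^ m * t := by positivity
  refine le_sInf ?_
  rintro _ ⟨W, _, _, _, R, -, hR, rfl⟩
  refine le_sInf ?_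
  rintro _ ⟨V, _, _, _, S, M, hM, hM1, hS, rfl⟩
  refine ENNReal.ofReal_le_ofReal ?_
  by_contra! hlt
  refine hx1 ((dominated_of_smul_mem S (Set.finite_range _) hp one_pos ?_).mono ?_ subset_rfl)
  · rintro _ ⟨j, rfl⟩
    have hmem : twoPoint m j (s : ℂ) (t : ℂ) ∈ ball (0 : EllOne) 1 := by
      rw [mem_ball_zero_iff]
      refine (norm_twoPoint_le _ _ _ _).trans_lt ?_
      rwa [Complex.norm_real, Complex.norm_real, Real.norm_of_nonneg hs.le,
        Real.norm_of_nonneg ht.le]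
    obtain ⟨w, hw, hwx⟩ := hS (hR ⟨_, hmem, rfl⟩)
    rw [taylorPoly_blockSeries hB hx, twoPoint_zero, block_twoPoint, smul_smul] at hwx
    refine ⟨w, ball_subset_closedBall (hM1 hw), ?_⟩
    rw [hwx]
    push_cast
    rfl
  · rw [div_mul_eq_mul_div, div_le_one hp, one_mul]
    exact hlt.le

end BlockSeries

end BanachOperatorIdeal

/-! ### Upper limits of `n`-th roots -/

theorem tendsto_ofReal_mul_pow_rpow_inv {s t : ℝ} (hs : 0 < s) (ht : 0 < t) :
    Tendsto (fun n : ℕ => ENNReal.ofReal (s ^ n * t) ^ (1 / (n : ℝ))) atTop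
      (𝓝 (ENNReal.ofReal s)) := by
  have h1 : Tendsto (fun n : ℕ => s * t ^ (1 / (n : ℝ))) atTop (𝓝 s) := by
    have h2 : Tendsto (fun n : ℕ => t ^ (1 / (n : ℝ))) atTop (𝓝 (t ^ (0 : ℝ))) :=
      (Real.continuousAt_const_rpow ht.ne').tendsto.comp tendsto_one_div_atTop_nhds_zero_nat
    simpa using h2.const_mul s
  refine (ENNReal.tendsto_ofReal h1).congr' ?_
  filter_upwards [eventually_ne_atTop 0] with n hn
  have hn' : (n : ℝ) ≠ 0 := by exact_mod_cast hn
  rw [ENNReal.ofReal_rpow_of_pos (by positivity), Real.mul_rpow (by positivity) ht.le,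
    ← Real.rpow_natCast, ← Real.rpow_mul hs.le, mul_one_div_cancel hn', Real.rpow_one]

/-- A sequence that is bounded above and decays slower than every geometric sequence has
`n`-th roots with upper limit `1`. -/
theorem limsup_rpow_inv_eq_one {b : ℕ → ℝ≥0∞} {C : ℝ} (hC : 0 < C)
    (hb : ∀ m, b (m + 1) ≤ ENNReal.ofReal C)
    (hlow : ∀ s : ℝ, 0 < s → s < 1 → ∃ t > 0, ∀ m, ENNReal.ofReal (s ^ m * t) ≤ b (m + 1)) :
    limsup (fun n : ℕ => b n ^ (1 / (n : ℝ))) atTop = 1 := by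
  refine le_antisymm ?_ ?_
  · have h := (tendsto_ofReal_mul_pow_rpow_inv one_pos hC).limsup_eq
    rw [ENNReal.ofReal_one] at h
    rw [← h]
    refine limsup_le_limsup ?_
    filter_upwards [eventually_ge_atTop 1] with n hn
    obtain ⟨m, rfl⟩ := Nat.exists_eq_add_of_le' hn
    refine ENNReal.rpow_le_rpow ?_ (by positivity)
    simpa using hb m
  · by_contra! hlt
    set L := limsup (fun n : ℕ => b n ^ (1 / (n : ℝ))) atTop
    have hL : L ≠ ⊤ := (hlt.trans ENNReal.one_lt_top).ne
    have hL1 : L.toReal < 1 := by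
      simpa using (ENNReal.toReal_lt_toReal hL ENNReal.one_ne_top).2 hlt
    have hL0 : 0 ≤ L.toReal := ENNReal.toReal_nonneg
    obtain ⟨s, hs0, hs1⟩ := exists_between hL1
    have hs : 0 < s := hL0.trans_lt hs0
    obtain ⟨t, ht, htb⟩ := hlow s hs hs1
    have hle : ENNReal.ofReal s ≤ L := by
      rw [← (tendsto_ofReal_mul_pow_rpow_inv hs ht).limsup_eq]
      refine limsup_le_limsup ?_
      filter_upwards [eventually_ge_atTop 1] with n hn
      obtain ⟨m, rfl⟩ := Nat.exists_eq_add_of_le' hn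
      refine ENNReal.rpow_le_rpow (le_trans (ENNReal.ofReal_le_ofReal ?_) (htb m)) (by positivity)
      rw [pow_succ]
      have := pow_pos hs m
      nlinarith [mul_pos this ht]
    exact absurd ((ENNReal.ofReal_le_iff_le_toReal hL).1 hle) (not_le.2 hs0)

/-! ### The boundary point `e₁` -/

theorem mainTheorem3 (𝒜 ℬ : BanachOperatorIdeal.{u}) (X : Type u) [NormedAddCommGroup X]
    [NormedSpace ℂ X] [CompleteSpace X]
    (hK : ∃ K : Set X, ℬ.RelCompact K ∧ ¬ 𝒜.RelCompact K) :
    ∃ f : EllOne → X,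
      AnalyticOnNhd ℂ f Set.univ ∧
      (∀ x, ℬ.CompactAt f x) ∧
      𝒜.CompactAt f 0 ∧
      𝒜.radius f 0 = 1 ∧
      (∀ x ∈ ball (0 : EllOne) 1, 𝒜.CompactAt f x) ∧
      ¬ 𝒜.CompactAt f EllOne.e₁ := by
  obtain ⟨K, ⟨Z, _, _, _, T, M, hM, hKM⟩, hKA⟩ := hK
  have hTM : ¬ 𝒜.RelCompact (T.1 '' M) := fun ⟨W, i1, i2, i3, S, L, hL, h⟩ =>
    hKA ⟨W, i1, i2, i3, S, L, hL, hKM.trans h⟩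
  have hblock : ∀ m : ℕ, ∃ (n : ℕ) (y : Fin n → Z), (∀ j, ‖y j‖ ≤ 1 / (m.factorial : ℝ)) ∧
      𝒜.Dominated 2 (Set.range fun j => T.1 (y j)) ∧
      ¬ 𝒜.Dominated 1 (Set.range fun j => T.1 (y j)) := by
    intro m
    obtain ⟨F₀, hF₀, hδ₀, h₀⟩ := BanachOperatorIdeal.exists_finite_not_dominated_one T.1 hM hTM
      (δ := 1 / (m.factorial : ℝ)) (by positivity)
    obtain ⟨F, hF, hδ, h2, h1⟩ := BanachOperatorIdeal.exists_scaled_dominated_two T.1 hF₀ h₀ hδ₀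
    obtain ⟨n, y, -, rfl⟩ := hF.fin_param
    have hr : T.1 '' Set.range y = Set.range fun j => T.1 (y j) := (Set.range_comp _ _).symm
    rw [hr] at h1 h2
    exact ⟨n, y, fun j => hδ _ ⟨j, rfl⟩, h2, h1⟩
  choose N y hy h2 h1 using hblock
  let x : ∀ m, Fin (N m) → X := fun m j => T.1 (y m j)
  have hx : ∀ m j, ‖x m j‖ ≤ ‖T.1‖ / (m.factorial : ℝ) := fun m j =>
    (T.1.le_opNorm_of_le (hy m j)).trans (le_of_eq (by ring))
  have hB : 0 ≤ ‖T.1‖ := norm_nonneg _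
  have hball : ∀ a ∈ ball (0 : EllOne) 1, 𝒜.CompactAt (EllOne.blockSeries x) a := fun a ha =>
    BanachOperatorIdeal.compactAt_blockSeries_of_mem_ball hB hx h2 ha
  have h0 : 𝒜.CompactAt (EllOne.blockSeries x) 0 := hball 0 (mem_ball_self one_pos)
  refine ⟨EllOne.blockSeries x, EllOne.analyticOnNhd_blockSeries hB hx, fun a => ?_, h0, ?_, hball,
    BanachOperatorIdeal.not_compactAt_blockSeries_e₁ h1⟩
  · obtain ⟨L, hL, hLs⟩ := EllOne.exists_isCompact_blockSeries zero_le_one hy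
      (R := ‖a‖ + 1) (by positivity)
    refine ⟨1, one_pos, Z, _, _, _, T, L, hL, ?_⟩
    rintro _ ⟨b, hb, rfl⟩
    refine ⟨EllOne.blockSeries y b, hLs ⟨b, ?_, rfl⟩, EllOne.map_blockSeries T.1 zero_le_one hy b⟩
    rw [mem_ball_iff_norm] at hb
    rw [mem_closedBall_zero_iff]
    linarith [norm_le_norm_add_norm_sub' b a]
  · rw [BanachOperatorIdeal.radius, if_pos h0, limsup_rpow_inv_eq_one (C := 4 * 2) (by norm_num)
      (fun m => BanachOperatorIdeal.polyNorm_taylorPoly_blockSeries_le hB hx (h2 m)), inv_one]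
    intro s hs0 hs1
    exact ⟨(1 - s) / 2, by linarith, fun m =>
      BanachOperatorIdeal.le_polyNorm_taylorPoly_blockSeries hB hx (h1 m) hs0 (by linarith) (by linarith)⟩
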